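/- Every $x\in[0,1)$ is written in base $4$ as $x=\sum_{k\ge1}\alpha_k(x)4^{-k}$ with $\alpha_k(x)\in\{0,1,2,3\}$, where numbers having two such expansions are given the one ending in zeros, and $1=\sum_{k\ge1}3\cdot4^{-k}$. For $i\in\{0,1,2,3\}$ let $N_i(x,n)=\#\{k\le n:\alpha_k(x)=i\}$, and let the frequency of $i$ in $x$ be $\nu_i(x)=\lim_{n\to\infty}N_i(x,n)/n$, if this limit exists. For $\theta\in(0,3)$ let $$S_\theta=\Big\{x\in[0,1]:\lim_{n\to\infty}\frac1n\sum_{k=1}^n\alpha_k(x)=\theta\Big\},\qquad \Theta_1=\{x\in S_\theta:\nu_i(x)\text{ exists for every }i\in\{0,1,2,3\}\},$$ and let $$C_1=\Big\{(\tau_0,\tau_1,\tau_2,\tau_3):\tau_i\ge0,\ \sum_{i=0}^3\tau_i=1,\ \tau_1+2\tau_2+3\tau_3=\theta\Big\},\qquad f(\tau)=\sum_{i=0}^3\tau_i\ln\tau_i\quad(0\ln0=0).$$ Theorem. Let $\theta\in(0,3)$. The set $\Theta_1$ has the cardinality of the continuum, is dense in $[0,1]$, and each of its points is a limit point of $\Theta_1$.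 Its Lebesgue measure is $0$ if $\theta\ne\frac32$; if $\theta=\frac32$, it has full Lebesgue measure in $[0,1]$, that is, measure $1$ and a complement in $[0,1]$ of measure $0$. The function $f$ attains its minimum on $C_1$, and if $m(\theta)$ denotes this minimum, then the Hausdorff dimension of $\Theta_1$ satisfies $$\dim_H\Theta_1\ \ge\ -\frac{m(\theta)}{\ln4}.$$ -/

import Mathlib

open Filter Topology MeasureTheory
open scoped ENNReal

namespace DigitMean

/-- The sequence of base-`4` digits of a number `x ∈ [0, 1]`: entry `k` is the digit `α_{k+1}(x)`.
For `x < 1` this is the representation `α_k(x) = ⌊4 ^ k * x⌋ mod 4`, which for numbers with two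
representations is the one with period `(0)`. The number `1` has only the representation with
period `(3)`. -/
noncomputable def digit (x : ℝ) : ℕ → Fin 4 :=
  if x = 1 then fun _ => 3 else Real.digits x 4

/-- `N_i(x, n)`: the number of occurrences of `i` among the first `n` digits of `x`. -/
noncomputable def digitCount (i : Fin 4) (x : ℝ) (n : ℕ) : ℕ :=
  ((Finset.range n).filter fun k => digit x k = i).card

/-- The digit `i` has frequency `ν_i(x) = τ`. -/
def HasFrequency (i : Fin 4) (x τ : ℝ) : Prop :=
  Tendsto (fun n : ℕ => (digitCount i x n : ℝ) / n) atTop (𝓝 τ)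

/-- The asymptotic mean of the digits of `x` exists and equals `θ`. -/
def HasDigitMean (x θ : ℝ) : Prop :=
  Tendsto (fun n : ℕ => (∑ k ∈ Finset.range n, ((digit x k : ℕ) : ℝ)) / n) atTop (𝓝 θ)

/-- The set `S_θ` of numbers in `[0, 1]` whose asymptotic mean of digits is `θ`. -/
def S (θ : ℝ) : Set ℝ := {x | x ∈ Set.Icc (0 : ℝ) 1 ∧ HasDigitMean x θ}

/-- The set `Θ₁` of the numbers in `S_θ` for which all four digit frequencies exist. -/
def Theta1 (θ : ℝ) : Set ℝ := {x | x ∈ S θ ∧ ∀ i : Fin 4, ∃ τ : ℝ, HasFrequency i x τ}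

/-- Probability vectors `τ` with `τ₁ + 2 τ₂ + 3 τ₃ = θ`. -/
def C1 (θ : ℝ) : Set (Fin 4 → ℝ) :=
  {τ | (∀ i, 0 ≤ τ i) ∧ ∑ i, τ i = 1 ∧ τ 1 + 2 * τ 2 + 3 * τ 3 = θ}

/-- `f(τ) = ∑ τ_i ln τ_i`; the convention `0 ln 0 = 0` holds automatically. -/
noncomputable def f (τ : Fin 4 → ℝ) : ℝ := ∑ i, τ i * Real.log (τ i)

/-- The infimum of `f` on `C1 θ` (that it is attained is part of the theorem). -/
noncomputable def m (θ : ℝ) : ℝ := sInf (f '' C1 θ)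

end DigitMean

/-! Draw the base-4 digits independently with law `τ ∈ C1 θ`. By the strong law of large numbers,
digit `i` almost surely has frequency `τ i`, so the random number almost surely lies in `Theta1 θ`.
The strong law for `log τ` says that the level-`n` cylinder around a typical sequence has mass `exp
(n * f τ + o(n))`; the mass distribution principle turns this into `dimH ≥ -f τ / log 4`
(`entropy_le_dimH`). By compactness of `C1 θ` some `τ` minimises `f`.

For uniform digits the law of the number is at most Lebesgue measure, so almost every number has all
frequencies `1/4` and hence mean `3/2`; this settles the measure claims.

The minimum of `f` is negative, so the dimension is positive and the set uncountable; being Borel,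
it has the cardinality of the continuum. Prepending digits preserves frequencies, so every 4-adic
interval contains a scaled copy of the set, which gives density and limit points. -/

namespace DigitMean

/-! ### Digit sequences and the numbers they represent -/

/-- The integer whose base-`4` digits are the first `n` terms of `ω`. -/
def prefixNum (ω : ℕ → Fin 4) : ℕ → ℕ
  | 0 => 0
  | n + 1 => 4 * prefixNum ω n + ω n

lemma sum_ofDigitsTerm_mul (ω : ℕ → Fin 4) (n : ℕ) :
    4 ^ n * ∑ k ∈ Finset.range n, Real.ofDigitsTerm ω k = prefixNum ω n := by
  induction n with
  | zero => simp [prefixNum]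
  | succ n ih =>
    rw [Finset.sum_range_succ, mul_add, pow_succ', mul_assoc, ih, Real.ofDigitsTerm, prefixNum]
    push_cast
    field_simp
    ring

lemma pow_mul_ofDigits (ω : ℕ → Fin 4) (n : ℕ) :
    4 ^ n * Real.ofDigits ω = prefixNum ω n + Real.ofDigits fun k => ω (k + n) := by
  rw [Real.ofDigits_eq_sum_add_ofDigits ω n, mul_add, sum_ofDigitsTerm_mul]
  push_cast
  field_simp

lemma prefixNum_le (ω : ℕ → Fin 4) (n : ℕ) : (prefixNum ω n : ℝ) ≤ 4 ^ n * Real.ofDigits ω := by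
  rw [pow_mul_ofDigits]
  linarith [Real.ofDigits_nonneg fun k => ω (k + n)]

lemma le_prefixNum_add_one (ω : ℕ → Fin 4) (n : ℕ) :
    4 ^ n * Real.ofDigits ω ≤ prefixNum ω n + 1 := by
  rw [pow_mul_ofDigits]
  linarith [Real.ofDigits_le_one fun k => ω (k + n)]

lemma prefixNum_lt (ω : ℕ → Fin 4) (n : ℕ) : prefixNum ω n < 4 ^ n := by
  induction n with
  | zero => simp [prefixNum]
  | succ n ih =>
    have := (ω n).isLt
    simp only [prefixNum, pow_succ']
    omega

lemma eq_of_prefixNum_eq {ω ω' : ℕ → Fin 4} {n : ℕ} (h : prefixNum ω n = prefixNum ω' n) :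
    ∀ k < n, ω k = ω' k := by
  induction n with
  | zero => simp
  | succ n ih =>
    have h1 := (ω n).isLt
    have h2 := (ω' n).isLt
    simp only [prefixNum] at h
    intro k hk
    rcases Nat.lt_succ_iff_lt_or_eq.1 hk with hk | rfl
    · exact ih (by omega) k hk
    · exact Fin.ext (by omega)

lemma ofDigits_lt_one {ω : ℕ → Fin 4} {k : ℕ} (hk : ω k ≠ 3) : Real.ofDigits ω < 1 := by
  have h1 := le_prefixNum_add_one ω (k + 1)
  have h2 : prefixNum ω (k + 1) + 2 ≤ 4 ^ (k + 1) := by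
    have := prefixNum_lt ω k
    have h3 : (ω k : ℕ) ≠ 3 := fun h => hk (Fin.ext h)
    have := (ω k).isLt
    simp only [prefixNum, pow_succ']
    omega
  have h3 : (prefixNum ω (k + 1) : ℝ) + 2 ≤ 4 ^ (k + 1) := by exact_mod_cast h2
  by_contra! h
  have : (4 : ℝ) ^ (k + 1) * 1 ≤ 4 ^ (k + 1) * Real.ofDigits ω := by gcongr
  linarith

/-- A digit sequence that is not eventually `3` is the digit sequence of the number it represents. -/
lemma digit_ofDigits {ω : ℕ → Fin 4} (h : ∃ᶠ k in atTop, ω k ≠ 3) :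
    digit (Real.ofDigits ω) = ω := by
  obtain ⟨k, hk⟩ := h.exists
  rw [digit, if_neg (ofDigits_lt_one hk).ne]
  funext n
  -- A later digit other than 3 keeps the tail strictly below 1, so the floor removes exactly the
  -- tail.
  obtain ⟨m, hm, hm3⟩ := frequently_atTop.1 h (n + 1)
  have h1 : Real.ofDigits (fun k => ω (k + (n + 1))) < 1 :=
    ofDigits_lt_one (k := m - (n + 1)) (by simpa [Nat.sub_add_cancel hm] using hm3)
  have h2 : ⌊Real.ofDigits ω * ((4 : ℕ) : ℝ) ^ (n + 1)⌋₊ = prefixNum ω (n + 1) := by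
    rw [mul_comm]
    push_cast
    rw [pow_mul_ofDigits, add_comm, Nat.floor_add_natCast (Real.ofDigits_nonneg _),
      Nat.floor_eq_zero.2 h1, zero_add]
  rw [Real.digits, h2, prefixNum]
  ext
  have := (ω n).isLt
  simp only [Fin.val_ofNat]
  omega

/-! ### Frequencies and the digit mean -/

lemma sum_indicator_eq_digitCount (i : Fin 4) (x : ℝ) (n : ℕ) :
    ∑ k ∈ Finset.range n, (if digit x k = i then (1 : ℝ) else 0) = digitCount i x n := by
  simp [digitCount]

lemma sum_digit_eq (x : ℝ) (n : ℕ) :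
    ∑ k ∈ Finset.range n, ((digit x k : ℕ) : ℝ) =
      digitCount 1 x n + 2 * digitCount 2 x n + 3 * digitCount 3 x n := by
  simp only [← sum_indicator_eq_digitCount, Finset.mul_sum, ← Finset.sum_add_distrib]
  refine Finset.sum_congr rfl fun k _ => ?_
  generalize digit x k = d
  fin_cases d <;> norm_num [Fin.ext_iff]

lemma hasDigitMean_of_hasFrequency {x : ℝ} {τ : Fin 4 → ℝ} (h : ∀ i, HasFrequency i x (τ i)) :
    HasDigitMean x (τ 1 + 2 * τ 2 + 3 * τ 3) := by
  have := ((h 1).add ((h 2).const_mul 2)).add ((h 3).const_mul 3)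
  refine this.congr fun n => ?_
  rw [sum_digit_eq]
  ring

lemma mem_Theta1_iff {θ x : ℝ} : x ∈ Theta1 θ ↔ x ∈ Set.Icc (0 : ℝ) 1 ∧
    ∃ τ : Fin 4 → ℝ, (∀ i, HasFrequency i x (τ i)) ∧ τ 1 + 2 * τ 2 + 3 * τ 3 = θ := by
  constructor
  · rintro ⟨⟨hx, hm⟩, h⟩
    choose τ hτ using h
    exact ⟨hx, τ, hτ, tendsto_nhds_unique (hasDigitMean_of_hasFrequency hτ) hm⟩
  · rintro ⟨hx, τ, hτ, rfl⟩
    exact ⟨⟨hx, hasDigitMean_of_hasFrequency hτ⟩, fun i => ⟨τ i, hτ i⟩⟩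

lemma ne_one_of_mem_Theta1 {θ x : ℝ} (hθ : θ < 3) (hx : x ∈ Theta1 θ) : x ≠ 1 := by
  rintro rfl
  have h : HasDigitMean 1 3 := by
    refine tendsto_const_nhds.congr' ?_
    filter_upwards [eventually_ge_atTop 1] with n hn
    have : (n : ℝ) ≠ 0 := by positivity
    simp [digit]
    field_simp
  exact hθ.ne (tendsto_nhds_unique hx.1.2 h)

/-! ### Density and limit points -/

/-- Prepending finitely many digits shifts the digit sequence. -/
lemma digit_shift {y : ℝ} (hy : y ∈ Set.Ico (0 : ℝ) 1) {j n : ℕ} (hj : j < 4 ^ n) (k : ℕ) :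
    digit ((j + y) / 4 ^ n) (n + k) = digit y k := by
  have h1 : ((j + y) / 4 ^ n : ℝ) ≠ 1 := by
    have : (j : ℝ) + 1 ≤ 4 ^ n := by exact_mod_cast hj
    exact ((div_lt_one (by positivity)).2 (by linarith [hy.2])).ne
  rw [digit, digit, if_neg h1, if_neg hy.2.ne, Real.digits, Real.digits]
  have h2 : ((j + y) / 4 ^ n : ℝ) * ((4 : ℕ) : ℝ) ^ (n + k + 1) =
      ((4 * (4 ^ k * j) : ℕ) : ℝ) + y * ((4 : ℕ) : ℝ) ^ (k + 1) := by
    push_cast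
    rw [add_assoc n, pow_add]
    field_simp
    ring
  rw [h2, add_comm, Nat.floor_add_natCast (mul_nonneg hy.1 (by positivity))]
  ext
  simp only [Fin.val_ofNat]
  omega

lemma hasFrequency_shift {y τ : ℝ} {i : Fin 4} (hy : y ∈ Set.Ico (0 : ℝ) 1) {j n : ℕ}
    (hj : j < 4 ^ n) (h : HasFrequency i y τ) : HasFrequency i ((j + y) / 4 ^ n) τ := by
  rw [HasFrequency, ← tendsto_add_atTop_iff_nat n]
  have h0 : Tendsto (fun N : ℕ => (digitCount i ((j + y) / 4 ^ n) n : ℝ) / N) atTop (𝓝 0) :=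
    tendsto_const_div_atTop_nhds_zero_nat _
  have h1 : Tendsto (fun N : ℕ => (N : ℝ) / ((N + n : ℕ) : ℝ)) atTop (𝓝 1) := by
    simpa using tendsto_natCast_div_add_atTop (n : ℝ)
  have h2 := (h0.add h).mul h1
  rw [zero_add, mul_one] at h2
  refine h2.congr' ?_
  filter_upwards [eventually_ge_atTop 1] with N hN
  have : (N : ℝ) ≠ 0 := by positivity
  have h3 : (digitCount i ((j + y) / 4 ^ n) (N + n) : ℝ) =
      digitCount i ((j + y) / 4 ^ n) n + digitCount i y N := by
    simp only [← sum_indicator_eq_digitCount]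
    rw [add_comm N n, Finset.sum_range_add]
    simp only [digit_shift hy hj]
  rw [h3, ← add_div]
  field_simp

lemma shift_mem_Theta1 {θ y : ℝ} (hθ : θ < 3) (hy : y ∈ Theta1 θ) {j n : ℕ} (hj : j < 4 ^ n) :
    (j + y) / 4 ^ n ∈ Theta1 θ := by
  have hy1 := ne_one_of_mem_Theta1 hθ hy
  obtain ⟨hI, τ, hτ, h⟩ := mem_Theta1_iff.1 hy
  have hlt := lt_of_le_of_ne hI.2 hy1
  have : (j : ℝ) + 1 ≤ 4 ^ n := by exact_mod_cast hj
  refine mem_Theta1_iff.2 ⟨⟨by have := hI.1; positivity, ?_⟩, τ, fun i =>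
    hasFrequency_shift ⟨hI.1, hlt⟩ hj (hτ i), h⟩
  exact (div_le_one (by positivity)).2 (by linarith)

/-- If `Theta1 θ` has two points, then it accumulates at every point of `[0, 1]`. -/
lemma mem_closure_Theta1_diff {θ x : ℝ} (hθ : θ < 3) (hne : (Theta1 θ).Nontrivial)
    (hx : x ∈ Set.Icc (0 : ℝ) 1) : x ∈ closure (Theta1 θ \ {x}) := by
  rw [Metric.mem_closure_iff]
  intro ε hε
  obtain ⟨n, hn⟩ := exists_pow_lt_of_lt_one hε (show (1 / 4 : ℝ) < 1 by norm_num)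
  have h4 : (0 : ℝ) < 4 ^ n := by positivity
  obtain ⟨j, hj, hj1, hj2⟩ : ∃ j : ℕ, j < 4 ^ n ∧ (j : ℝ) ≤ 4 ^ n * x ∧ 4 ^ n * x ≤ j + 1 := by
    rcases hx.2.eq_or_lt with rfl | h1
    -- At `x = 1` the floor would be `4 ^ n`, one too large; the last interval is used instead.
    · refine ⟨4 ^ n - 1, Nat.sub_lt (by positivity) one_pos, ?_, ?_⟩ <;>
      simp [Nat.cast_sub (Nat.one_le_pow n 4 (by norm_num))]
    · have h0 : 0 ≤ 4 ^ n * x := mul_nonneg h4.le hx.1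
      refine ⟨⌊4 ^ n * x⌋₊, (Nat.floor_lt h0).2 ?_, Nat.floor_le h0, (Nat.lt_floor_add_one _).le⟩
      push_cast
      nlinarith
  have key : ∀ y ∈ Theta1 θ, dist x ((j + y) / 4 ^ n) < ε := by
    intro y hy
    have hI := hy.1.1
    have h1 : |x - (j + y) / 4 ^ n| ≤ (1 / 4) ^ n := by
      have h2 : x - (j + y) / 4 ^ n = (4 ^ n * x - j - y) / 4 ^ n := by field_simp; ring
      rw [h2, abs_div, abs_of_pos h4, one_div_pow]
      gcongr
      rw [abs_le]
      constructor <;> linarith [hI.1, hI.2]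
    exact (Real.dist_eq _ _).trans_lt (h1.trans_lt hn)
  -- Two points have distinct copies in the interval, so at least one copy differs from `x`.
  obtain ⟨y, hy, y', hy', hyy⟩ := hne
  by_cases h : ((j + y) / 4 ^ n : ℝ) = x
  · refine ⟨(j + y') / 4 ^ n, ⟨shift_mem_Theta1 hθ hy' hj, fun h' => hyy ?_⟩, key y' hy'⟩
    have := h.trans (Set.mem_singleton_iff.1 h').symm
    field_simp at this
    linarith
  · exact ⟨_, ⟨shift_mem_Theta1 hθ hy hj, h⟩, key y hy⟩

/-! ### Measurability -/

lemma measurable_digit (k : ℕ) : Measurable fun x => digit x k := by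
  have : (fun x => digit x k) = fun x => if x = 1 then 3 else Real.digits x 4 k := by
    funext x
    unfold digit
    split_ifs <;> rfl
  rw [this]
  refine Measurable.ite (measurableSet_singleton 1) measurable_const ?_
  exact (measurable_from_top (f := fun m : ℕ => Fin.ofNat 4 m)).comp
    (Nat.measurable_floor.comp (measurable_id.mul_const _))

lemma measurable_digitCount (i : Fin 4) (n : ℕ) :
    Measurable fun x => (digitCount i x n : ℝ) := by
  simp only [← sum_indicator_eq_digitCount]
  exact Finset.measurable_sum _ fun k _ =>
    (measurable_from_top (f := fun d : Fin 4 => if d = i then (1 : ℝ) else 0)).comp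
      (measurable_digit k)

lemma measurableSet_hasFrequency (i : Fin 4) (τ : ℝ) :
    MeasurableSet {x | HasFrequency i x τ} :=
  measurableSet_tendsto _ fun n => (measurable_digitCount i n).div_const _

lemma measurableSet_Theta1 (θ : ℝ) : MeasurableSet (Theta1 θ) := by
  have h1 : MeasurableSet {x | HasDigitMean x θ} := measurableSet_tendsto _ fun n =>
    (Finset.measurable_sum _ fun k _ => (measurable_from_top (f := fun d : Fin 4 =>
      ((d : ℕ) : ℝ))).comp (measurable_digit k)).div_const _
  have h2 : MeasurableSet {x | ∀ i : Fin 4, ∃ τ : ℝ, HasFrequency i x τ} := by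
    simp only [Set.ofPred_forall]
    exact MeasurableSet.iInter fun i => measurableSet_exists_tendsto fun n =>
      (measurable_digitCount i n).div_const _
  exact (measurableSet_Icc.inter h1).inter h2

/-! ### Independent random digits -/

/-- The law of a sequence of independent digits with distribution `p`. -/
noncomputable def seqMeasure (p : PMF (Fin 4)) : Measure (ℕ → Fin 4) :=
  Measure.infinitePi fun _ => p.toMeasure

instance (p : PMF (Fin 4)) : IsProbabilityMeasure (seqMeasure p) := by
  unfold seqMeasure
  infer_instance

lemma seqMeasure_cylinder (p : PMF (Fin 4)) (ω : ℕ → Fin 4) (n : ℕ) :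
    seqMeasure p {ω' | ∀ k < n, ω' k = ω k} = ∏ k ∈ Finset.range n, p (ω k) := by
  have h : {ω' : ℕ → Fin 4 | ∀ k < n, ω' k = ω k} =
      Set.pi (Finset.range n : Set ℕ) fun k => {ω k} := by
    ext ω'
    simp [Set.mem_pi]
  rw [h, seqMeasure, Measure.infinitePi_pi _ fun _ _ => measurableSet_singleton _]
  exact Finset.prod_congr rfl fun k _ =>
    PMF.toMeasure_apply_singleton _ _ (measurableSet_singleton _)

/-- Each fibre of `prefixNum` that meets `B` lies in the cylinder of a point of `B`, so its mass is
at most `c`. -/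
lemma seqMeasure_prefixNum_mem_le (p : PMF (Fin 4)) {B : Set (ℕ → Fin 4)} {n : ℕ} {c : ℝ≥0∞}
    (hB : ∀ ω ∈ B, ∏ k ∈ Finset.range n, p (ω k) ≤ c) (J : Finset ℕ) :
    seqMeasure p ({ω | prefixNum ω n ∈ J} ∩ B) ≤ J.card * c := by
  have h1 : {ω | prefixNum ω n ∈ J} ∩ B ⊆ ⋃ j ∈ J, {ω | prefixNum ω n = j} ∩ B := by
    rintro ω ⟨hJ, hω⟩
    simp only [Set.mem_iUnion]
    exact ⟨_, hJ, rfl, hω⟩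
  have h2 : ∀ j ∈ J, seqMeasure p ({ω | prefixNum ω n = j} ∩ B) ≤ c := by
    intro j _
    rcases ({ω | prefixNum ω n = j} ∩ B).eq_empty_or_nonempty with h | ⟨ω, hω, hωB⟩
    · simp [h]
    · refine le_trans (measure_mono ?_) ((seqMeasure_cylinder p ω n).trans_le (hB ω hωB))
      rintro ω' ⟨hω', -⟩
      exact eq_of_prefixNum_eq (Eq.trans hω' hω.symm)
  calc _ ≤ _ := measure_mono h1
    _ ≤ ∑ j ∈ J, seqMeasure p ({ω | prefixNum ω n = j} ∩ B) := measure_biUnion_finset_le _ _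
    _ ≤ ∑ _j ∈ J, c := Finset.sum_le_sum h2
    _ = _ := by simp

/-- A number in `[a, b]` has its level-`n` prefix in `[4 ^ n * a - 1, 4 ^ n * b]`, which holds at
most `4 ^ n * (b - a) + 2` integers. -/
lemma seqMeasure_ofDigits_mem_Icc_le (p : PMF (Fin 4)) {B : Set (ℕ → Fin 4)} {n : ℕ} {c : ℝ≥0∞}
    (hB : ∀ ω ∈ B, ∏ k ∈ Finset.range n, p (ω k) ≤ c) {a b : ℝ} (hab : a ≤ b) :
    seqMeasure p (Real.ofDigits ⁻¹' Set.Icc a b ∩ B) ≤ ENNReal.ofReal (4 ^ n * (b - a) + 2) * c := by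
  set J := Finset.Icc ⌈4 ^ n * a - 1⌉₊ ⌊4 ^ n * b⌋₊ with hJ
  have h1 : Real.ofDigits ⁻¹' Set.Icc a b ⊆ {ω : ℕ → Fin 4 | prefixNum ω n ∈ J} := by
    rintro ω ⟨ha, hb⟩
    have ha' : (4 : ℝ) ^ n * a ≤ 4 ^ n * Real.ofDigits ω := by gcongr
    have hb' : (4 : ℝ) ^ n * Real.ofDigits ω ≤ 4 ^ n * b := by gcongr
    refine Finset.mem_Icc.2 ⟨Nat.ceil_le.2 ?_, Nat.le_floor ?_⟩
    · linarith [le_prefixNum_add_one ω n]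
    · linarith [prefixNum_le ω n]
  have h2 : (J.card : ℝ) ≤ 4 ^ n * (b - a) + 2 := by
    have h0 : (0 : ℝ) ≤ 4 ^ n * (b - a) := mul_nonneg (by positivity) (by linarith)
    rw [hJ, Nat.card_Icc]
    rcases lt_or_ge b 0 with h | h
    · rw [Nat.floor_of_nonpos (mul_nonpos_of_nonneg_of_nonpos (by positivity) h.le)]
      have : ((0 + 1 - ⌈4 ^ n * a - 1⌉₊ : ℕ) : ℝ) ≤ 1 := by exact_mod_cast Nat.sub_le _ _
      linarith
    · rcases le_total ⌈4 ^ n * a - 1⌉₊ (⌊4 ^ n * b⌋₊ + 1) with h' | h'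
      · rw [Nat.cast_sub h']
        push_cast
        linarith [Nat.floor_le (a := 4 ^ n * b) (by positivity), Nat.le_ceil (4 ^ n * a - 1)]
      · rw [Nat.sub_eq_zero_of_le h', Nat.cast_zero]
        linarith
  refine (measure_mono (Set.inter_subset_inter_left B h1)).trans
    ((seqMeasure_prefixNum_mem_le p hB J).trans ?_)
  gcongr
  rw [← ENNReal.ofReal_natCast]
  exact ENNReal.ofReal_le_ofReal h2

/-- The strong law of large numbers for functions of independent digits. -/
lemma ae_tendsto_average (p : PMF (Fin 4)) (g : Fin 4 → ℝ) :
    ∀ᵐ ω ∂seqMeasure p, Tendsto (fun n : ℕ => (∑ k ∈ Finset.range n, g (ω k)) / n) atTop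
      (𝓝 (∑ i, (p i).toReal * g i)) := by
  have hg : Measurable g := measurable_from_top
  have hmap : ∀ k, Measure.map (fun ω : ℕ → Fin 4 => ω k) (seqMeasure p) = p.toMeasure :=
    fun k => Measure.infinitePi_map_eval _ k
  have hm : ∀ k, Measurable fun ω : ℕ → Fin 4 => ω k := fun k => measurable_pi_apply k
  have hind : ProbabilityTheory.iIndepFun (fun k (ω : ℕ → Fin 4) => g (ω k)) (seqMeasure p) :=
    ProbabilityTheory.iIndepFun_infinitePi (X := fun _ => g) fun _ => hg
  have hint : ∫ ω, g (ω 0) ∂seqMeasure p = ∑ i, (p i).toReal * g i := by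
    rw [← integral_map (φ := fun ω : ℕ → Fin 4 => ω 0) (f := g) (hm 0).aemeasurable
      hg.aestronglyMeasurable, hmap, PMF.integral_eq_sum]
    rfl
  rw [← hint]
  refine ProbabilityTheory.strong_law_ae_real (fun k (ω : ℕ → Fin 4) => g (ω k)) ?_
    (fun i j hij => hind.indepFun hij) fun k => ?_
  · exact Integrable.comp_measurable (f := fun ω : ℕ → Fin 4 => ω 0) (g := g)
      (by rw [hmap]; exact .of_finite) (hm 0)
  · exact ProbabilityTheory.IdentDistrib.comp (u := g)
      ⟨(hm k).aemeasurable, (hm 0).aemeasurable, by rw [hmap, hmap]⟩ hg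

/-- If `p 3 ≠ 1`, almost no sequence is eventually 3, so the random sequence is the chosen expansion
of its number. -/
lemma ae_hasFrequency {p : PMF (Fin 4)} (hp : (p 3).toReal ≠ 1) :
    ∀ᵐ ω ∂seqMeasure p, ∀ i, HasFrequency i (Real.ofDigits ω) (p i).toReal := by
  have h : ∀ᵐ ω ∂seqMeasure p, ∀ i : Fin 4, Tendsto (fun n : ℕ =>
      (∑ k ∈ Finset.range n, (if ω k = i then (1 : ℝ) else 0)) / n) atTop (𝓝 (p i).toReal) := by
    rw [ae_all_iff]
    intro i
    simpa using ae_tendsto_average p fun j => if j = i then 1 else 0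
  filter_upwards [h] with ω hω
  have h3 : ∃ᶠ k in atTop, ω k ≠ 3 := by
    intro hev
    have h1 : Tendsto (fun k => if ω k = 3 then (1 : ℝ) else 0) atTop (𝓝 1) := by
      refine tendsto_const_nhds.congr' ?_
      filter_upwards [hev] with k hk
      rw [if_pos (not_not.1 hk)]
    refine hp (tendsto_nhds_unique (hω 3) (h1.cesaro.congr fun n => ?_))
    rw [div_eq_inv_mul]
  intro i
  refine (hω i).congr fun n => ?_
  rw [← sum_indicator_eq_digitCount, digit_ofDigits h3]

lemma ofDigits_mem_Icc (ω : ℕ → Fin 4) : Real.ofDigits ω ∈ Set.Icc (0 : ℝ) 1 :=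
  ⟨Real.ofDigits_nonneg ω, Real.ofDigits_le_one ω⟩

lemma measurable_ofDigits : Measurable (Real.ofDigits : (ℕ → Fin 4) → ℝ) :=
  Real.continuous_ofDigits.measurable

/-! ### Lebesgue measure -/

/-- Independent uniform digits represent a number whose law is bounded by Lebesgue measure. -/
lemma map_ofDigits_uniform_le_volume :
    (seqMeasure (PMF.uniformOfFintype (Fin 4))).map Real.ofDigits ≤ volume := by
  set p := PMF.uniformOfFintype (Fin 4) with hp
  have hI : ∀ a b : ℝ, a ≤ b →
      (seqMeasure p).map Real.ofDigits (Set.Icc a b) ≤ ENNReal.ofReal (b - a) := by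
    intro a b hab
    rw [Measure.map_apply measurable_ofDigits measurableSet_Icc]
    have h1 : ∀ n : ℕ, seqMeasure p (Real.ofDigits ⁻¹' Set.Icc a b) ≤
        ENNReal.ofReal (b - a + 2 * (1 / 4) ^ n) := by
      intro n
      have := seqMeasure_ofDigits_mem_Icc_le p (B := Set.univ) (n := n)
        (c := ENNReal.ofReal ((1 / 4) ^ n)) (fun ω _ => ?_) hab
      · rw [Set.inter_univ, ← ENNReal.ofReal_mul' (by positivity)] at this
        refine this.trans_eq ?_
        congr 1
        rw [one_div_pow]
        field_simp
      · rw [hp]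
        simp [ENNReal.ofReal_pow, ENNReal.ofReal_inv_of_pos, ← mul_pow,
          ENNReal.inv_mul_cancel (show (4 : ℝ≥0∞) ≠ 0 by norm_num)
            (show (4 : ℝ≥0∞) ≠ ∞ by exact ENNReal.ofNat_ne_top)]
    have h2 : Tendsto (fun n : ℕ => ENNReal.ofReal (b - a + 2 * (1 / 4) ^ n)) atTop
        (𝓝 (ENNReal.ofReal (b - a + 2 * 0))) :=
      ENNReal.tendsto_ofReal ((tendsto_pow_atTop_nhds_zero_of_lt_one (by norm_num)
        (by norm_num)).const_mul 2 |>.const_add _)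
    rw [mul_zero, add_zero] at h2
    exact ge_of_tendsto' h2 h1
  -- As Lebesgue measure is `μH[1]`, a bound by diameter suffices, and a bounded set lies in an
  -- interval of its own diameter.
  rw [← hausdorffMeasure_real]
  refine Measure.le_hausdorffMeasure 1 _ 1 one_pos fun s hs => ?_
  rcases s.eq_empty_or_nonempty with rfl | hne
  · simp
  have hb : Bornology.IsBounded s :=
    Metric.isBounded_iff_ediam_ne_top.2 (hs.trans_lt ENNReal.one_lt_top).ne
  rw [ENNReal.rpow_one, Real.ediam_eq hb]
  exact (measure_mono (subset_Icc_csInf_csSup hb.bddBelow hb.bddAbove)).trans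
    (hI _ _ (csInf_le_csSup hne hb.bddBelow hb.bddAbove))

/-- The numbers in `[0, 1]` in which each digit has frequency `1 / 4`. -/
def balanced : Set ℝ := {x | x ∈ Set.Icc (0 : ℝ) 1 ∧ ∀ i, HasFrequency i x (1 / 4)}

/-- Lebesgue almost every number has all digit frequencies equal to `1 / 4`. -/
lemma volume_balanced :
    volume balanced = 1 := by
  refine le_antisymm ?_ ?_
  · calc _ ≤ volume (Set.Icc (0 : ℝ) 1) := measure_mono fun x hx => hx.1
      _ = 1 := by simp
  · refine le_trans ?_ (map_ofDigits_uniform_le_volume _)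
    refine le_trans ?_ (Measure.le_map_apply measurable_ofDigits.aemeasurable _)
    have h := ae_hasFrequency (p := PMF.uniformOfFintype (Fin 4)) (by norm_num)
    rw [← measure_univ (μ := seqMeasure (PMF.uniformOfFintype (Fin 4)))]
    refine measure_mono_ae ?_
    filter_upwards [h] with ω hω _
    exact ⟨ofDigits_mem_Icc ω, fun i => by simpa using hω i⟩

lemma measurableSet_balanced :
    MeasurableSet balanced := by
  refine measurableSet_Icc.inter (?_ : MeasurableSet {x | _})
  rw [Set.ofPred_forall]
  exact MeasurableSet.iInter fun i => measurableSet_hasFrequency i _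

lemma volume_Icc_diff_balanced :
    volume (Set.Icc (0 : ℝ) 1 \ balanced) =
      0 := by
  rw [measure_sdiff (fun x hx => hx.1) measurableSet_balanced.nullMeasurableSet
    (by rw [volume_balanced]; exact ENNReal.one_ne_top), volume_balanced]
  simp

lemma hasDigitMean_of_uniform {x : ℝ} (h : ∀ i, HasFrequency i x (1 / 4)) :
    HasDigitMean x (3 / 2) := by
  have := hasDigitMean_of_hasFrequency (τ := fun _ => 1 / 4) h
  norm_num at this
  exact this

lemma volume_Theta1_of_ne {θ : ℝ} (hθ : θ ≠ 3 / 2) : volume (Theta1 θ) = 0 := by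
  have h : Theta1 θ ⊆ Set.Icc (0 : ℝ) 1 \ balanced := fun x hx => ⟨hx.1.1, fun hb =>
    hθ (tendsto_nhds_unique hx.1.2 (hasDigitMean_of_uniform hb.2))⟩
  exact measure_mono_null h volume_Icc_diff_balanced

lemma balanced_subset_Theta1 :
    balanced ⊆ Theta1 (3 / 2) :=
  fun _ hx => ⟨⟨hx.1, hasDigitMean_of_uniform hx.2⟩, fun i => ⟨_, hx.2 i⟩⟩

lemma volume_Icc_diff_Theta1 : volume (Set.Icc (0 : ℝ) 1 \ Theta1 (3 / 2)) = 0 :=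
  measure_mono_null (Set.sdiff_subset_sdiff_right balanced_subset_Theta1)
    volume_Icc_diff_balanced

lemma volume_Theta1_three_halves : volume (Theta1 (3 / 2)) = 1 := by
  refine le_antisymm ?_ (volume_balanced.symm.trans_le
    (measure_mono balanced_subset_Theta1))
  calc _ ≤ volume (Set.Icc (0 : ℝ) 1) := measure_mono fun x hx => hx.1.1
    _ = 1 := by simp

/-! ### Hausdorff dimension -/

/-- A mass distribution estimate: if the cylinders of level `n ≥ N` around points of `B` have mass
at most `4 ^ (-n s)`, then small sets carry little of the mass of `B`. -/
lemma map_restrict_ofDigits_le (p : PMF (Fin 4)) {B : Set (ℕ → Fin 4)} {s : ℝ} (hs : 0 < s) {N : ℕ}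
    (hB : ∀ ω ∈ B, ∀ n ≥ N, ∏ k ∈ Finset.range n, p (ω k) ≤ ENNReal.ofReal (((1 / 4) ^ n) ^ s))
    {U : Set ℝ} (hU : Metric.ediam U ≤ ENNReal.ofReal ((1 / 4) ^ N)) :
    ((seqMeasure p).restrict B).map Real.ofDigits U ≤
      ENNReal.ofReal (4 * 4 ^ s) * Metric.ediam U ^ s := by
  rcases U.eq_empty_or_nonempty with rfl | ⟨x, hx⟩
  · simp
  set D := (Metric.ediam U).toReal with hD
  have hDU : Metric.ediam U = ENNReal.ofReal D :=
    (ENNReal.ofReal_toReal (hU.trans_lt ENNReal.ofReal_lt_top).ne).symm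
  have hD0 : 0 ≤ D := ENNReal.toReal_nonneg
  have hDN : D ≤ (1 / 4) ^ N := by
    rw [hDU] at hU
    exact (ENNReal.ofReal_le_ofReal_iff (by positivity)).1 hU
  have key : ∀ r : ℝ, 0 < r → D ≤ r → r ≤ (1 / 4) ^ N →
      ((seqMeasure p).restrict B).map Real.ofDigits U ≤ ENNReal.ofReal (4 * 4 ^ s * r ^ s) := by
    intro r hr0 hDr hrN
    -- With `4⁻ⁿ⁻¹ < r ≤ 4⁻ⁿ`, the interval of length `2r` has prefix count at most `4ⁿ * 2r + 2 ≤
    -- 4`, and `4⁻ⁿ < 4r` gives the factor `4 ^ s`.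
    obtain ⟨n, hn1, hn2⟩ := exists_nat_pow_near_of_lt_one hr0
      (hrN.trans (pow_le_one₀ (by norm_num) (by norm_num))) (show (0 : ℝ) < 1 / 4 by norm_num)
      (by norm_num)
    have hnN : N ≤ n := by
      by_contra! h
      have : (1 / 4 : ℝ) ^ N ≤ (1 / 4) ^ (n + 1) :=
        pow_le_pow_of_le_one (by norm_num) (by norm_num) h
      linarith
    have hsub : U ⊆ Set.Icc (x - r) (x + r) := by
      intro y hy
      have h1 : edist y x ≤ ENNReal.ofReal r :=
        (Metric.edist_le_ediam_of_mem hy hx).trans (hDU.trans_le (ENNReal.ofReal_le_ofReal hDr))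
      rw [edist_dist, ENNReal.ofReal_le_ofReal_iff hr0.le, Real.dist_eq, abs_le] at h1
      constructor <;> linarith [h1.1, h1.2]
    have h2 := seqMeasure_ofDigits_mem_Icc_le p (fun ω hω => hB ω hω n hnN)
      (show x - r ≤ x + r by linarith)
    refine (measure_mono hsub).trans ?_
    rw [Measure.map_apply measurable_ofDigits measurableSet_Icc,
      Measure.restrict_apply (measurable_ofDigits measurableSet_Icc)]
    refine h2.trans ?_
    rw [← ENNReal.ofReal_mul' (by positivity), mul_assoc, ← Real.mul_rpow (by norm_num) hr0.le]
    refine ENNReal.ofReal_le_ofReal ?_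
    gcongr
    · rw [one_div_pow] at hn2
      have : 4 ^ n * r ≤ 1 := by
        rw [le_div_iff₀ (by positivity)] at hn2
        linarith
      linarith
    · rw [pow_succ] at hn1
      linarith
  rw [hDU, ENNReal.ofReal_rpow_of_nonneg hD0 hs.le, ← ENNReal.ofReal_mul (by positivity)]
  -- A set of diameter 0 has no scale of its own; let `r` decrease to 0.
  rcases hD0.eq_or_lt with h0 | h0
  · have h1 : Tendsto (fun r : ℝ => ENNReal.ofReal (4 * 4 ^ s * r ^ s)) (𝓝[>] 0)
        (𝓝 (ENNReal.ofReal (4 * 4 ^ s * 0 ^ s))) :=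
      ENNReal.tendsto_ofReal (((Real.continuousAt_rpow_const 0 s (.inr hs.le)).tendsto.const_mul
        _).mono_left nhdsWithin_le_nhds)
    rw [← h0]
    refine ge_of_tendsto h1 ?_
    filter_upwards [Ioc_mem_nhdsGT (show (0 : ℝ) < (1 / 4) ^ N by positivity)] with r hr
    exact key r hr.1 (h0 ▸ hr.1.le) hr.2
  · exact key D h0 le_rfl hDN

/-- A set that carries almost surely the number with independent digits of law `p` has at least
the dimension given by the entropy of `p`. -/
lemma entropy_le_dimH {p : PMF (Fin 4)} {A : Set ℝ}
    (hA : ∀ᵐ ω ∂seqMeasure p, Real.ofDigits ω ∈ A) :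
    ENNReal.ofReal (-(∑ i, (p i).toReal * Real.log (p i).toReal) / Real.log 4) ≤ dimH A := by
  refine ENNReal.le_of_forall_nnreal_lt fun s hs => ?_
  rcases eq_or_ne s 0 with rfl | hs0
  · simp
  have hs0' : (0 : ℝ) < s := by positivity
  have hlog : 0 < Real.log 4 := Real.log_pos (by norm_num)
  have hs' : ∑ i, (p i).toReal * Real.log (p i).toReal < -(s * Real.log 4) := by
    rw [ENNReal.lt_ofReal_iff_toReal_lt ENNReal.coe_ne_top, ENNReal.coe_toReal,
      lt_div_iff₀ hlog] at hs
    linarith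
  set B : ℕ → Set (ℕ → Fin 4) := fun N => {ω | ∀ n ≥ N,
    ∏ k ∈ Finset.range n, p (ω k) ≤ ENNReal.ofReal (((1 / 4) ^ n) ^ (s : ℝ))} with hBdef
  have hBU : seqMeasure p (⋃ N, B N) ≠ 0 := by
    have h1 : (⋃ N, B N) ∈ ae (seqMeasure p) := by
      filter_upwards [ae_tendsto_average p fun i => Real.log (p i).toReal] with ω hω
      obtain ⟨N, hN⟩ := eventually_atTop.1 (hω.eventually (gt_mem_nhds hs'))
      refine Set.mem_iUnion.2 ⟨N + 1, fun n hn => ?_⟩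
      have hn0 : (0 : ℝ) < n := by exact_mod_cast (Nat.succ_pos N).trans_le hn
      have h2 := hN n ((Nat.le_succ N).trans hn)
      rw [div_lt_iff₀ hn0] at h2
      have h3 : ∏ k ∈ Finset.range n, (p (ω k)).toReal ≤ ((1 / 4) ^ n) ^ (s : ℝ) := by
        -- Only `≤`: a digit of probability 0 has `Real.log 0 = 0`, hence exponential 1.
        calc ∏ k ∈ Finset.range n, (p (ω k)).toReal
            ≤ ∏ k ∈ Finset.range n, Real.exp (Real.log (p (ω k)).toReal) :=
              Finset.prod_le_prod (fun _ _ => ENNReal.toReal_nonneg) fun _ _ => Real.le_exp_log _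
          _ = Real.exp (∑ k ∈ Finset.range n, Real.log (p (ω k)).toReal) :=
              (Real.exp_sum _ _).symm
          _ ≤ Real.exp (Real.log ((1 / 4) ^ n) * s) := by
              rw [Real.exp_le_exp, Real.log_pow, one_div, Real.log_inv]
              linarith
          _ = _ := (Real.rpow_def_of_pos (by positivity) _).symm
      rw [← ENNReal.toReal_prod] at h3
      exact (ENNReal.le_ofReal_iff_toReal_le
        (ENNReal.prod_ne_top fun k _ => p.apply_ne_top _) (by positivity)).2 h3
    rw [measure_congr (eventuallyEq_univ.2 h1), measure_univ]
    exact one_ne_zero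
  obtain ⟨N, hN⟩ := exists_measure_pos_of_not_measure_iUnion_null hBU
  refine le_dimH_of_hausdorffMeasure_ne_zero ?_
  set ν := ((seqMeasure p).restrict (B N)).map Real.ofDigits with hν
  have hC : ENNReal.ofReal (4 * 4 ^ (s : ℝ)) ≠ 0 := (ENNReal.ofReal_pos.2 (by positivity)).ne'
  have h1 : (ENNReal.ofReal (4 * 4 ^ (s : ℝ)))⁻¹ • ν ≤ μH[s] := by
    refine Measure.le_hausdorffMeasure s _ (ENNReal.ofReal ((1 / 4) ^ N))
      (ENNReal.ofReal_pos.2 (by positivity)) fun U hU => ?_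
    rw [Measure.smul_apply, smul_eq_mul, ENNReal.inv_mul_le_iff hC ENNReal.ofReal_ne_top]
    exact map_restrict_ofDigits_le p hs0' (fun ω hω => hω) hU
  have h2 : 0 < ν A := by
    refine lt_of_lt_of_le ?_ (Measure.le_map_apply measurable_ofDigits.aemeasurable A)
    refine hN.trans_le ?_
    rw [← Measure.restrict_apply_self]
    refine measure_mono_ae ?_
    filter_upwards [ae_restrict_of_ae hA] with ω hω _ using hω
  refine (lt_of_lt_of_le ?_ (h1 A)).ne'
  rw [Measure.smul_apply, smul_eq_mul]
  exact ENNReal.mul_pos (ENNReal.inv_ne_zero.2 ENNReal.ofReal_ne_top) h2.ne'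

lemma f_le_dimH_Theta1 {θ : ℝ} (hθ : θ < 3) {τ : Fin 4 → ℝ} (hτ : τ ∈ C1 θ) :
    ENNReal.ofReal (-f τ / Real.log 4) ≤ dimH (Theta1 θ) := by
  obtain ⟨h0, h1, h2⟩ := hτ
  let p : PMF (Fin 4) := PMF.ofFintype (fun i => ENNReal.ofReal (τ i)) (by
    rw [← ENNReal.ofReal_sum_of_nonneg fun i _ => h0 i, h1, ENNReal.ofReal_one])
  have hp : ∀ i, (p i).toReal = τ i := fun i => ENNReal.toReal_ofReal (h0 i)
  have h3 : (p 3).toReal ≠ 1 := by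
    rw [hp]
    intro h
    linarith [h0 1, h0 2]
  have := entropy_le_dimH (p := p) (A := Theta1 θ) (by
    filter_upwards [ae_hasFrequency h3] with ω hω
    exact mem_Theta1_iff.2 ⟨ofDigits_mem_Icc ω, τ, fun i => hp i ▸ hω i, h2⟩)
  simpa only [hp, f] using this

/-! ### The minimum of `f`, and cardinality -/

lemma isCompact_C1 (θ : ℝ) : IsCompact (C1 θ) := by
  refine (isCompact_univ_pi fun _ : Fin 4 => isCompact_Icc (a := (0 : ℝ)) (b := 1)).of_isClosed_subset
    ?_ ?_
  · refine IsClosed.inter (?_ : IsClosed {τ | _}) (IsClosed.inter (?_ : IsClosed {τ | _})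
      (?_ : IsClosed {τ | _}))
    · rw [Set.ofPred_forall]
      exact isClosed_iInter fun i => isClosed_le continuous_const (continuous_apply i)
    · exact isClosed_eq (by fun_prop) continuous_const
    · exact isClosed_eq (by fun_prop) continuous_const
  · rintro τ ⟨h0, h1, -⟩ i -
    exact ⟨h0 i, h1 ▸ Finset.single_le_sum (fun j _ => h0 j) (Finset.mem_univ i)⟩

lemma continuous_f : Continuous f :=
  continuous_finsetSum _ fun i _ => Real.continuous_mul_log.comp (continuous_apply i)

lemma vec_mem_C1 {θ : ℝ} (hθ : θ ∈ Set.Ioo (0 : ℝ) 3) : ![1 - θ / 3, 0, 0, θ / 3] ∈ C1 θ := by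
  obtain ⟨h0, h3⟩ := hθ
  refine ⟨fun i => ?_, ?_, ?_⟩
  · fin_cases i <;> simp <;> linarith
  · simp [Fin.sum_univ_four]
  · simp
    ring

lemma isLeast_m {θ : ℝ} (hθ : θ ∈ Set.Ioo (0 : ℝ) 3) : IsLeast (f '' C1 θ) (m θ) := by
  have h := (isCompact_C1 θ).image continuous_f
  exact ⟨h.sInf_mem ⟨_, _, vec_mem_C1 hθ, rfl⟩, fun _ hy => csInf_le h.bddBelow hy⟩

lemma m_neg {θ : ℝ} (hθ : θ ∈ Set.Ioo (0 : ℝ) 3) : m θ < 0 := by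
  refine ((isLeast_m hθ).2 ⟨_, vec_mem_C1 hθ, rfl⟩).trans_lt ?_
  obtain ⟨h0, h3⟩ := hθ
  have h1 : (1 - θ / 3) * Real.log (1 - θ / 3) < 0 :=
    mul_neg_of_pos_of_neg (by linarith) (Real.log_neg (by linarith) (by linarith))
  have h2 : θ / 3 * Real.log (θ / 3) < 0 :=
    mul_neg_of_pos_of_neg (by linarith) (Real.log_neg (by linarith) (by linarith))
  simp [f, Fin.sum_univ_four]
  linarith

lemma neg_m_div_log_le_dimH {θ : ℝ} (hθ : θ ∈ Set.Ioo (0 : ℝ) 3) :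
    ENNReal.ofReal (-m θ / Real.log 4) ≤ dimH (Theta1 θ) := by
  obtain ⟨τ, hτ, h⟩ := (isLeast_m hθ).1
  rw [← h]
  exact f_le_dimH_Theta1 hθ.2 hτ

lemma not_countable_Theta1 {θ : ℝ} (hθ : θ ∈ Set.Ioo (0 : ℝ) 3) : ¬(Theta1 θ).Countable := by
  intro h
  have h1 := neg_m_div_log_le_dimH hθ
  rw [dimH_countable h, nonpos_iff_eq_zero, ENNReal.ofReal_eq_zero] at h1
  exact h1.not_gt (div_pos (neg_pos.2 (m_neg hθ)) (Real.log_pos (by norm_num)))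

lemma mk_Theta1 {θ : ℝ} (hθ : θ ∈ Set.Ioo (0 : ℝ) 3) :
    Cardinal.mk (Theta1 θ) = Cardinal.continuum := by
  have := (measurableSet_Theta1 θ).standardBorel
  have h1 : ¬Countable (Theta1 θ) := fun h => not_countable_Theta1 hθ (Set.countable_coe_iff.1 h)
  have h2 : ¬Countable ℝ := not_countable_iff.2 inferInstance
  rw [← Cardinal.mk_real]
  exact Cardinal.mk_congr (PolishSpace.measurableEquivOfNotCountable h1 h2).toEquiv

end DigitMean

theorem theorem2 (θ : ℝ) (hθ : θ ∈ Set.Ioo (0 : ℝ) 3) :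
    Cardinal.mk (DigitMean.Theta1 θ) = Cardinal.continuum ∧
    Set.Icc (0 : ℝ) 1 ⊆ closure (DigitMean.Theta1 θ) ∧
    (∀ x ∈ DigitMean.Theta1 θ, AccPt x (𝓟 (DigitMean.Theta1 θ))) ∧
    (θ ≠ 3 / 2 → volume (DigitMean.Theta1 θ) = 0) ∧
    (θ = 3 / 2 → volume (Set.Icc (0 : ℝ) 1 \ DigitMean.Theta1 θ) = 0 ∧
      volume (DigitMean.Theta1 θ) = 1) ∧
    IsLeast (DigitMean.f '' DigitMean.C1 θ) (DigitMean.m θ) ∧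
    ENNReal.ofReal (-DigitMean.m θ / Real.log 4) ≤ dimH (DigitMean.Theta1 θ) := by
  have hne : (DigitMean.Theta1 θ).Nontrivial := by
    by_contra h
    exact DigitMean.not_countable_Theta1 hθ (Set.not_nontrivial_iff.1 h).countable
  refine ⟨DigitMean.mk_Theta1 hθ, fun x hx => ?_, fun x hx => ?_, DigitMean.volume_Theta1_of_ne,
    ?_, DigitMean.isLeast_m hθ, DigitMean.neg_m_div_log_le_dimH hθ⟩
  · exact closure_mono Set.sdiff_subset (DigitMean.mem_closure_Theta1_diff hθ.2 hne hx)
  · exact accPt_principal_iff_clusterPt.2 (mem_closure_iff_clusterPt.1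
      (DigitMean.mem_closure_Theta1_diff hθ.2 hne hx.1.1))
  · rintro rfl
    exact ⟨DigitMean.volume_Icc_diff_Theta1, DigitMean.volume_Theta1_three_halves⟩
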